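/- Let $(\mathcal B,\mathbb E,\mathfrak s)$ be an extriangulated category (in the sense of Nakaoka–Palu) with enough projectives and enough injectives; let $\mathcal P$, $\mathcal I$ be the full subcategories of projectives and injectives. A conflation is a sequence $A\rightarrowtail B\twoheadrightarrow C$ that realizes some $\delta\in\mathbb E(C,A)$. For full subcategories $\mathcal D_1,\mathcal D_2\subseteq\mathcal B$, let $\mathrm{Cone}(\mathcal D_1,\mathcal D_2)$ be the full subcategory of the objects $X$ that admit a conflation $D_1\rightarrowtail D_2\twoheadrightarrow X$ with $D_i\in\mathcal D_i$, let $\mathcal D_1\ast\mathcal D_2$ be that of the objects $X$ that admit a conflation $D_1\rightarrowtail X\twoheadrightarrow D_2$ with $D_i\in\mathcal D_i$, put $\Sigma^0\mathcal D=\mathcal D$ and $\Sigma^{i}\mathcal D=\mathrm{Cone}(\Sigma^{i-1}\mathcal D,\mathcal I)$ for $i\ge1$, let ${}^{\perp_1}\mathcal D$ be the full subcategory of the objects $X$ with $\mathbb E(X,\mathcal D)=0$, and let $\mathrm{add}\,\mathcal D$ be the closure of $\mathcal D$ under direct summands in $\mathcal B$. For objects $X,Y$ and $i\ge0$ put $\mathbb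 E^{i+1}(X,Y)=\mathbb E(X,\Sigma^iY)$, where $\Sigma^0Y=Y$ and $\Sigma^{i+1}Y$ is given by a conflation $\Sigma^{i}Y\rightarrowtail I\twoheadrightarrow\Sigma^{i+1}Y$ with $I\in\mathcal I$. A cotorsion pair is a pair $(\mathcal U,\mathcal V)$ of full additive subcategories of $\mathcal B$, closed under isomorphisms and direct summands, such that $\mathbb E(\mathcal U,\mathcal V)=0$ and every object $B$ admits conflations $V_B\rightarrowtail U_B\twoheadrightarrow B$ and $B\rightarrowtail V^B\twoheadrightarrow U^B$ with $U_B,U^B\in\mathcal U$ and $V_B,V^B\in\mathcal V$. Its core is $\mathcal U\cap\mathcal V$, its kernel is $\mathcal K=\mathrm{add}(\mathcal U\ast\mathcal V)$, and its coheart is $\mathcal C={}^{\perp_1}\mathcal K=\mathcal U\cap{}^{\perp_1}\mathcal U$. Write $(\mathcal U,\mathcal V)\ge(\mathcal U',\mathcal V')$ if $\mathcal U\subseteq\mathcal U'$ and $\mathcal V'\subseteq\mathcal V$. Let $n\ge2$ and let $\mathcal M\subseteq\mathcal B$ be an $n$-cluster tilting subcategory, that is, a full subcategory that is contravariantly finite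 and covariantly finite and satisfies, for every object $X$, $$X\in\mathcal M\iff \mathbb E^i(X,\mathcal M)=0\ (1\le i\le n-1)\iff\mathbb E^i(\mathcal M,X)=0\ (1\le i\le n-1).$$ Put $\mathcal M_1=\mathcal M$, $\mathcal M_\ell=\mathrm{Cone}(\mathcal M_{\ell-1},\mathcal M)$ for $\ell>1$, and $\mathcal Y_\ell=\Sigma^{\ell-1}\mathcal M_{n-\ell}$ for $1\le\ell\le n-1$. Then $(\mathcal M_\ell,\mathcal Y_\ell)$ is a cotorsion pair for every $1\le\ell\le n-1$, and $$(\mathcal M_1,\mathcal Y_1)\ge(\mathcal M_2,\mathcal Y_2)\ge\cdots\ge(\mathcal M_{n-1},\mathcal Y_{n-1}).$$ Each $(\mathcal M_\ell,\mathcal Y_\ell)$ has core $\mathcal M_\ell\cap\mathcal Y_\ell=\Sigma^{\ell-1}\mathcal M$, coheart $\mathcal M$ and kernel $\mathcal M_{n-1}$. -/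

import Mathlib

open CategoryTheory CategoryTheory.Limits Opposite

universe w v u

namespace ExtriCat

section Extensions

variable {B : Type u} [Category.{v} B]

/-- The group `𝔼(Z, A)` of `𝔼`-extensions. -/
abbrev Extn (E : Bᵒᵖ ⥤ B ⥤ AddCommGrpCat.{w}) (Z A : B) : Type w :=
  (E.obj (op Z)).obj A

/-- `a_* δ = 𝔼(Z, a)(δ)`. -/
def push (E : Bᵒᵖ ⥤ B ⥤ AddCommGrpCat.{w}) {Z A A' : B} (a : A ⟶ A')
    (δ : Extn E Z A) : Extn E Z A' :=
  ((E.obj (op Z)).map a).hom δ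

/-- `c^* δ = 𝔼(c, A)(δ)`. -/
def pull (E : Bᵒᵖ ⥤ B ⥤ AddCommGrpCat.{w}) {Z Z' A : B} (c : Z' ⟶ Z)
    (δ : Extn E Z A) : Extn E Z' A :=
  ((E.map c.op).app A).hom δ

/-- The direct sum `δ ⊕ δ' ∈ 𝔼(Z ⊕ Z', A ⊕ A')`: the extension with components
`(δ, 0, 0, δ')`. -/
noncomputable def dsum [Preadditive B] [HasBinaryBiproducts B]
    (E : Bᵒᵖ ⥤ B ⥤ AddCommGrpCat.{w}) {Z A Z' A' : B}
    (δ : Extn E Z A) (δ' : Extn E Z' A') : Extn E (Z ⊞ Z') (A ⊞ A') :=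
  pull E biprod.fst (push E biprod.inl δ) + pull E biprod.snd (push E biprod.inr δ')

/-- Sequences of two composable morphisms `A ⟶ mid ⟶ Z` with fixed ends. -/
structure Seq (A Z : B) where
  mid : B
  x : A ⟶ mid
  y : mid ⟶ Z

/-- Two sequences are equivalent if there is an isomorphism of the middle terms compatible
with the identities of the ends. -/
def Seq.Equivalent {A Z : B} (S S' : Seq A Z) : Prop :=
  ∃ b : S.mid ≅ S'.mid, S.x ≫ b.hom = S'.x ∧ b.hom ≫ S'.y = S.y

instance Seq.setoid (A Z : B) : Setoid (Seq A Z) where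
  r := Seq.Equivalent
  iseqv :=
    { refl := fun S => ⟨Iso.refl _, by simp, by simp⟩
      symm := by
        rintro S S' ⟨b, h1, h2⟩
        exact ⟨b.symm, by simp [← h1], by simp [← h2]⟩
      trans := by
        rintro S S' S'' ⟨b, h1, h2⟩ ⟨c, h3, h4⟩
        exact ⟨b ≪≫ c, by simp [← h3, ← h1], by simp [h4, h2]⟩ }

/-- Equivalence classes of sequences `A ⟶ mid ⟶ Z`. -/
abbrev SeqClass (A Z : B) : Type (max u v) := Quotient (Seq.setoid A Z)

/-- The class `[A ⟶ M ⟶ Z]`. -/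
def seqClass {A M Z : B} (x : A ⟶ M) (y : M ⟶ Z) : SeqClass A Z :=
  Quotient.mk (Seq.setoid A Z) ⟨M, x, y⟩

end Extensions

/-- An extriangulated structure `(𝔼, 𝔰)` on an additive category `B`. -/
structure Extriangulated (B : Type u) [Category.{v} B] [Preadditive B] [HasZeroObject B]
    [HasBinaryBiproducts B] where
  /-- the bifunctor `𝔼` -/
  E : Bᵒᵖ ⥤ B ⥤ AddCommGrpCat.{w}
  /-- (ET1): `𝔼` is additive in both arguments -/
  additive_left : E.Additive
  additive_right : ∀ Z : Bᵒᵖ, (E.obj Z).Additive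
  /-- the correspondence `𝔰` -/
  s : ∀ {Z A : B}, Extn E Z A → SeqClass A Z
  /-- (ET2): `𝔰` is a realization -/
  realize_hom : ∀ {A M Z A' M' Z' : B} (δ : Extn E Z A) (δ' : Extn E Z' A')
    (x : A ⟶ M) (y : M ⟶ Z) (x' : A' ⟶ M') (y' : M' ⟶ Z'),
    s δ = seqClass x y → s δ' = seqClass x' y' →
    ∀ (a : A ⟶ A') (c : Z ⟶ Z'), push E a δ = pull E c δ' →
      ∃ b : M ⟶ M', x ≫ b = a ≫ x' ∧ y ≫ c = b ≫ y'
  /-- (ET2): `𝔰` is additive, part (i) -/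
  realize_zero : ∀ A Z : B, s (0 : Extn E Z A) =
    seqClass (biprod.inl : A ⟶ A ⊞ Z) (biprod.snd : A ⊞ Z ⟶ Z)
  /-- (ET2): `𝔰` is additive, part (ii) -/
  realize_dsum : ∀ {A M Z A' M' Z' : B} (δ : Extn E Z A) (δ' : Extn E Z' A')
    (x : A ⟶ M) (y : M ⟶ Z) (x' : A' ⟶ M') (y' : M' ⟶ Z'),
    s δ = seqClass x y → s δ' = seqClass x' y' →
      s (dsum E δ δ') = seqClass (biprod.map x x') (biprod.map y y')
  /-- (ET3) -/
  et3 : ∀ {A M Z A' M' Z' : B} (δ : Extn E Z A) (δ' : Extn E Z' A')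
    (x : A ⟶ M) (y : M ⟶ Z) (x' : A' ⟶ M') (y' : M' ⟶ Z'),
    s δ = seqClass x y → s δ' = seqClass x' y' →
    ∀ (a : A ⟶ A') (b : M ⟶ M'), x ≫ b = a ≫ x' →
      ∃ c : Z ⟶ Z', push E a δ = pull E c δ' ∧ y ≫ c = b ≫ y'
  /-- (ET3)ᵒᵖ -/
  et3op : ∀ {A M Z A' M' Z' : B} (δ : Extn E Z A) (δ' : Extn E Z' A')
    (x : A ⟶ M) (y : M ⟶ Z) (x' : A' ⟶ M') (y' : M' ⟶ Z'),
    s δ = seqClass x y → s δ' = seqClass x' y' →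
    ∀ (b : M ⟶ M') (c : Z ⟶ Z'), y ≫ c = b ≫ y' →
      ∃ a : A ⟶ A', push E a δ = pull E c δ' ∧ x ≫ b = a ≫ x'
  /-- (ET4) -/
  et4 : ∀ {A M D N F : B} (δ : Extn E D A) (δ' : Extn E F M)
    (f : A ⟶ M) (f' : M ⟶ D) (g : M ⟶ N) (g' : N ⟶ F),
    s δ = seqClass f f' → s δ' = seqClass g g' →
    ∃ (K : B) (h' : N ⟶ K) (d : D ⟶ K) (e : K ⟶ F) (δ'' : Extn E K A),
      f' ≫ d = g ≫ h' ∧ h' ≫ e = g' ∧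
      s δ'' = seqClass (f ≫ g) h' ∧
      s (push E f' δ') = seqClass d e ∧
      pull E d δ'' = δ ∧
      push E f δ'' = pull E e δ'
  /-- (ET4)ᵒᵖ -/
  et4op : ∀ {D N M F A : B} (δ : Extn E M D) (δ' : Extn E A F)
    (f' : D ⟶ N) (f : N ⟶ M) (g' : F ⟶ M) (g : M ⟶ A),
    s δ = seqClass f' f → s δ' = seqClass g' g →
    ∃ (K : B) (h' : K ⟶ N) (d : D ⟶ K) (e : K ⟶ F) (δ'' : Extn E A K),
      e ≫ g' = h' ≫ f ∧ d ≫ h' = f' ∧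
      s δ'' = seqClass h' (f ≫ g) ∧
      s (pull E g' δ) = seqClass d e ∧
      push E e δ'' = δ' ∧
      pull E g δ'' = push E d δ

namespace Extriangulated

variable {B : Type u} [Category.{v} B] [Preadditive B] [HasZeroObject B]
  [HasBinaryBiproducts B] (T : Extriangulated.{w} B)

/-- The sequence `A ⟶ M ⟶ Z` realizes some extension. -/
def Conflation {A M Z : B} (x : A ⟶ M) (y : M ⟶ Z) : Prop :=
  ∃ δ : Extn T.E Z A, T.s δ = seqClass x y

def Inflation {A M : B} (x : A ⟶ M) : Prop :=
  ∃ (Z : B) (y : M ⟶ Z), T.Conflation x y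

def Deflation {M Z : B} (y : M ⟶ Z) : Prop :=
  ∃ (A : B) (x : A ⟶ M), T.Conflation x y

/-- The full subcategory `𝒫` of objects `P` with `𝔼(P, B) = 0`. -/
def projectives : ObjectProperty B := fun P => ∀ (A : B) (δ : Extn T.E P A), δ = 0

/-- The full subcategory `ℐ` of objects `I` with `𝔼(B, I) = 0`. -/
def injectives : ObjectProperty B := fun I => ∀ (Z : B) (δ : Extn T.E Z I), δ = 0

def EnoughProjectives : Prop :=
  ∀ Z : B, ∃ (P : B) (p : P ⟶ Z), T.projectives P ∧ T.Deflation p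

def EnoughInjectives : Prop :=
  ∀ A : B, ∃ (I : B) (i : A ⟶ I), T.injectives I ∧ T.Inflation i

/-- `Cone(𝒟₁, 𝒟₂)`: objects `Z` with a conflation `D₁ ⟶ D₂ ⟶ Z`. -/
def cone (D₁ D₂ : ObjectProperty B) : ObjectProperty B := fun Z =>
  ∃ (X Y : B) (x : X ⟶ Y) (y : Y ⟶ Z), D₁ X ∧ D₂ Y ∧ T.Conflation x y

/-- `𝒟₁ ∗ 𝒟₂`: objects `M` with a conflation `D₁ ⟶ M ⟶ D₂`. -/
def star (D₁ D₂ : ObjectProperty B) : ObjectProperty B := fun M =>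
  ∃ (X Y : B) (x : X ⟶ M) (y : M ⟶ Y), D₁ X ∧ D₂ Y ∧ T.Conflation x y

/-- `{}^{⊥₁}𝒟`: objects `X` with `𝔼(X, 𝒟) = 0`. -/
def leftPerp (D : ObjectProperty B) : ObjectProperty B := fun X =>
  ∀ A : B, D A → ∀ δ : Extn T.E X A, δ = 0

/-- The subcategory version of the cosyzygy: `Σ⁰ 𝒟 = 𝒟` and
`Σⁱ⁺¹ 𝒟 = Cone(Σⁱ 𝒟, ℐ)`. -/
def cosyzygies (D : ObjectProperty B) : ℕ → ObjectProperty B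
  | 0 => D
  | i + 1 => T.cone (cosyzygies D i) T.injectives

end Extriangulated

section Summands

variable {B : Type u} [Category.{v} B] [Preadditive B] [HasBinaryBiproducts B]

/-- `add 𝒟`: the direct summands of objects in `𝒟`. -/
def addClosure (D : ObjectProperty B) : ObjectProperty B := fun X =>
  ∃ X' Y : B, D Y ∧ Nonempty (X ⊞ X' ≅ Y)

/-- Full additive subcategories that are closed under isomorphisms and direct summands. -/
structure IsAdditiveSummandClosed (D : ObjectProperty B) : Prop where
  zero : ∀ X : B, IsZero X → D X
  biprod : ∀ X Y : B, D X → D Y → D (X ⊞ Y)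
  iso : ∀ X Y : B, (X ≅ Y) → D X → D Y
  summand : ∀ X Y : B, D (X ⊞ Y) → D X

/-- Every object has a right `𝒟`-approximation. -/
def ContravariantlyFinite (D : ObjectProperty B) : Prop :=
  ∀ X : B, ∃ (Y : B) (f : Y ⟶ X), D Y ∧
    ∀ (Y' : B) (g : Y' ⟶ X), D Y' → ∃ h : Y' ⟶ Y, h ≫ f = g

/-- Every object has a left `𝒟`-approximation. -/
def CovariantlyFinite (D : ObjectProperty B) : Prop :=
  ∀ X : B, ∃ (Y : B) (f : X ⟶ Y), D Y ∧
    ∀ (Y' : B) (g : X ⟶ Y'), D Y' → ∃ h : Y ⟶ Y', f ≫ h = g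

end Summands

namespace Extriangulated

variable {B : Type u} [Category.{v} B] [Preadditive B] [HasZeroObject B]
  [HasBinaryBiproducts B] (T : Extriangulated.{w} B)

/-- `(𝒰, 𝒱)` is a (complete) cotorsion pair. -/
structure IsCotorsionPair (U V : ObjectProperty B) : Prop where
  left_closed : IsAdditiveSummandClosed U
  right_closed : IsAdditiveSummandClosed V
  ext_zero : ∀ X Y : B, U X → V Y → ∀ δ : Extn T.E X Y, δ = 0
  /-- conflations `V_Z ⟶ U_Z ⟶ Z` -/
  left_approx : ∀ Z : B, ∃ (K L : B) (x : K ⟶ L) (y : L ⟶ Z), V K ∧ U L ∧ T.Conflation x y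
  /-- conflations `Z ⟶ V^Z ⟶ U^Z` -/
  right_approx : ∀ Z : B, ∃ (K L : B) (x : Z ⟶ K) (y : K ⟶ L), V K ∧ U L ∧ T.Conflation x y

/-- The core `𝒰 ∩ 𝒱` of a cotorsion pair. -/
def core (U V : ObjectProperty B) : ObjectProperty B := fun X => U X ∧ V X

/-- The kernel `add(𝒰 ∗ 𝒱)` of a cotorsion pair. -/
def kernel (U V : ObjectProperty B) : ObjectProperty B := addClosure (T.star U V)

/-- The coheart `{}^{⊥₁}𝒦` of a cotorsion pair with kernel `𝒦`. -/
def coheart (U V : ObjectProperty B) : ObjectProperty B := T.leftPerp (T.kernel U V)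

/-- A chosen cosyzygy `ΣX`: there is a conflation `X ⟶ I ⟶ ΣX` with `I` injective. -/
noncomputable def cosyzygy (hI : T.EnoughInjectives) (X : B) : B :=
  (hI X).choose_spec.choose_spec.2.choose

/-- The iterated cosyzygy `ΣⁱX` of an object. -/
noncomputable def iterCosyzygy (hI : T.EnoughInjectives) (X : B) : ℕ → B
  | 0 => X
  | i + 1 => T.cosyzygy hI (iterCosyzygy hI X i)

/-- The higher extension group `𝔼ⁱ⁺¹(X, Y) = 𝔼(X, ΣⁱY)`. -/
abbrev HigherExtSucc (hI : T.EnoughInjectives) (i : ℕ) (X Y : B) : Type w :=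
  Extn T.E X (T.iterCosyzygy hI Y i)

/-- `ℳ` is an `n`-cluster tilting subcategory. The index `i` below stands for the degree
`i + 1`, which runs over `1, …, n - 1`. -/
structure IsClusterTilting (hI : T.EnoughInjectives) (n : ℕ) (M : ObjectProperty B) : Prop where
  contravariantlyFinite : ContravariantlyFinite M
  covariantlyFinite : CovariantlyFinite M
  mem_iff_left : ∀ X : B, M X ↔
    ∀ i : ℕ, i + 1 < n → ∀ Y : B, M Y → ∀ δ : T.HigherExtSucc hI i X Y, δ = 0
  mem_iff_right : ∀ X : B, M X ↔
    ∀ i : ℕ, i + 1 < n → ∀ Y : B, M Y → ∀ δ : T.HigherExtSucc hI i Y X, δ = 0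

/-- `ℳ₁ = ℳ` and `ℳ_ℓ = Cone(ℳ_{ℓ-1}, ℳ)` for `ℓ > 1`; the value at `0` is a convention. -/
def layer (M : ObjectProperty B) : ℕ → ObjectProperty B
  | 0 => T.injectives
  | 1 => M
  | ℓ + 2 => T.cone (layer M (ℓ + 1)) M

/-- `𝒴_ℓ = Σ^{ℓ-1} ℳ_{n-ℓ}`, for `1 ≤ ℓ ≤ n - 1`. -/
def colayer (n : ℕ) (M : ObjectProperty B) (ℓ : ℕ) : ObjectProperty B :=
  T.cosyzygies (T.layer M (n - ℓ)) (ℓ - 1)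

end Extriangulated

end ExtriCat

/-! Write `Ω` for syzygies, `Σ` for cosyzygies and `𝒟^{⊥₁}` for `T.rightPerp 𝒟`. Dimension shifting
(`extZero_iterCosyzygy_iff`) replaces `𝔼(Y, ΣⁱX) = 0` by `𝔼(ΩⁱY, X) = 0`, so belonging to `M` is a
vanishing condition on `X` for fixed first arguments. By induction with right `M`-approximations,
`layer_succ_iff` describes every layer this way: `M_ℓ` is cut out by `𝔼(ΩⁱM, X) = 0` for `i + ℓ <
n`. Closure under extensions and summands, monotonicity and `M_{n-1} = M^{⊥₁}` follow.

The second pillar is `colayer_eq`, the equality `𝒴_ℓ = M_ℓ^{⊥₁}`. Its hard inclusion presents an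
object of the orthogonal as a cosyzygy, using an injective `M`-approximation. This reverses the
order on the right halves and yields the core. The approximation conflations come from an induction
on `ℓ` in `exists_rightPerp_coresolution`. A pullback of such a conflation identifies the kernel
with `M^{⊥₁}` (`kernel_eq`); the coheart is then `M`, because an `M`-approximation with kernel in
`M^{⊥₁}` splits. -/

namespace ExtriCat

open scoped ZeroObject

/-! ### Functoriality of extensions. -/

section Bifunctor

variable {B : Type u} [Category.{v} B] (E : Bᵒᵖ ⥤ B ⥤ AddCommGrpCat.{w})

@[simp] lemma push_id {Z A : B} (δ : Extn E Z A) : push E (𝟙 A) δ = δ := by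
  simp [push]

@[simp] lemma pull_id {Z A : B} (δ : Extn E Z A) : pull E (𝟙 Z) δ = δ := by
  simp [pull]

lemma push_comp {Z A A' A'' : B} (a : A ⟶ A') (a' : A' ⟶ A'') (δ : Extn E Z A) :
    push E (a ≫ a') δ = push E a' (push E a δ) := by
  simp [push]

lemma pull_comp {Z Z' Z'' A : B} (c : Z' ⟶ Z) (c' : Z'' ⟶ Z') (δ : Extn E Z A) :
    pull E (c' ≫ c) δ = pull E c' (pull E c δ) := by
  simp [pull]

@[simp] lemma push_zero {Z A A' : B} (a : A ⟶ A') : push E a (0 : Extn E Z A) = 0 :=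
  map_zero _

@[simp] lemma pull_zero {Z Z' A : B} (c : Z' ⟶ Z) : pull E c (0 : Extn E Z A) = 0 :=
  map_zero _

lemma push_add {Z A A' : B} (a : A ⟶ A') (δ δ' : Extn E Z A) :
    push E a (δ + δ') = push E a δ + push E a δ' :=
  map_add _ _ _

lemma pull_add {Z Z' A : B} (c : Z' ⟶ Z) (δ δ' : Extn E Z A) :
    pull E c (δ + δ') = pull E c δ + pull E c δ' :=
  map_add _ _ _

lemma push_pull {Z Z' A A' : B} (a : A ⟶ A') (c : Z' ⟶ Z) (δ : Extn E Z A) :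
    push E a (pull E c δ) = pull E c (push E a δ) := by
  have h := (E.map c.op).naturality a
  exact (congrArg (fun f => f.hom δ) h).symm

end Bifunctor

lemma seqClass_eq_iff {B : Type u} [Category.{v} B] {A Z M M' : B} {x : A ⟶ M} {y : M ⟶ Z}
    {x' : A ⟶ M'} {y' : M' ⟶ Z} :
    seqClass x y = seqClass x' y' ↔ ∃ b : M ≅ M', x ≫ b.hom = x' ∧ b.hom ≫ y' = y :=
  Quotient.eq

namespace Extriangulated

variable {B : Type u} [Category.{v} B] [Preadditive B] [HasZeroObject B]
  [HasBinaryBiproducts B] (T : Extriangulated.{w} B)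

lemma add_push {Z A A' : B} (a a' : A ⟶ A') (δ : Extn T.E Z A) :
    push T.E (a + a') δ = push T.E a δ + push T.E a' δ := by
  have := T.additive_right (op Z)
  simp [push, Functor.map_add]

lemma zero_push {Z A A' : B} (δ : Extn T.E Z A) : push T.E (0 : A ⟶ A') δ = 0 := by
  have := T.additive_right (op Z)
  simp [push]

lemma zero_pull {Z Z' A : B} (δ : Extn T.E Z A) : pull T.E (0 : Z' ⟶ Z) δ = 0 := by
  have := T.additive_left
  simp [pull]

lemma exists_realization {Z A : B} (δ : Extn T.E Z A) :
    ∃ (M : B) (x : A ⟶ M) (y : M ⟶ Z), T.s δ = seqClass x y := by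
  obtain ⟨S, hS⟩ := Quotient.exists_rep (T.s δ)
  exact ⟨S.mid, S.x, S.y, hS.symm⟩

/-! ### Exact sequences attached to a conflation. -/

section Exactness

variable {T} {A M Z : B} {δ : Extn T.E Z A} {x : A ⟶ M} {y : M ⟶ Z}
  (h : T.s δ = seqClass x y)

include h

lemma push_inflation : push T.E x δ = 0 := by
  obtain ⟨c, hc, -⟩ := T.et3 δ _ x y _ _ h (T.realize_zero M (0 : B)) x biprod.inl rfl
  simpa using hc

lemma pull_deflation : pull T.E y δ = 0 := by
  obtain ⟨a, ha, -⟩ := T.et3op _ δ _ _ x y (T.realize_zero (0 : B) M) h biprod.snd y rfl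
  simpa using ha.symm

lemma exists_lift_of_pull_eq_zero {X : B} (f : X ⟶ Z) (hf : pull T.E f δ = 0) :
    ∃ g : X ⟶ M, g ≫ y = f := by
  obtain ⟨b, -, hb⟩ := T.realize_hom _ δ _ _ x y (T.realize_zero A X) h (𝟙 A) f (by simp [hf])
  exact ⟨biprod.inr ≫ b, by simp [← hb]⟩

lemma exists_extension_of_push_eq_zero {X : B} (f : A ⟶ X) (hf : push T.E f δ = 0) :
    ∃ g : M ⟶ X, x ≫ g = f := by
  obtain ⟨b, hb, -⟩ := T.realize_hom δ _ x y _ _ h (T.realize_zero X Z) f (𝟙 Z) (by simp [hf])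
  exact ⟨b ≫ biprod.fst, by simp [reassoc_of% hb]⟩

lemma exists_desc {X : B} (f : M ⟶ X) (hf : x ≫ f = 0) : ∃ g : Z ⟶ X, y ≫ g = f := by
  obtain ⟨c, -, hc⟩ := T.et3 δ _ x y _ _ h (T.realize_zero (0 : B) X) 0 (f ≫ biprod.inr)
    (by simp [reassoc_of% hf])
  exact ⟨c, by simpa using hc⟩

lemma exists_pull_eq {X : B} (η : Extn T.E X A) (hη : push T.E x η = 0) :
    ∃ g : X ⟶ Z, η = pull T.E g δ := by
  obtain ⟨N, p, q, hN⟩ := T.exists_realization η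
  obtain ⟨t, ht⟩ := exists_extension_of_push_eq_zero hN x hη
  obtain ⟨c, hc, -⟩ := T.et3 η δ p q x y hN h (𝟙 A) t (by simp [ht])
  exact ⟨c, by simpa using hc⟩

lemma exists_push_eq {X : B} (η : Extn T.E Z X) (hη : pull T.E y η = 0) :
    ∃ g : A ⟶ X, η = push T.E g δ := by
  obtain ⟨N, p, q, hN⟩ := T.exists_realization η
  obtain ⟨t, ht⟩ := exists_lift_of_pull_eq_zero hN y hη
  obtain ⟨a, ha, -⟩ := T.et3op δ η x y p q h hN t (𝟙 Z) (by simp [ht])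
  exact ⟨a, by simpa using ha.symm⟩

/-- (ET4) for `x` followed by the inflation of `η` yields a conflation `Z ⟶ K ⟶ X` realizing `y_*
η`. It splits, and pulling the extension `δ''` of `K` by `A` back along a section gives the preimage
of `η`. -/
lemma exists_push_inflation_eq {X : B} (η : Extn T.E X M) (hη : push T.E y η = 0) :
    ∃ η' : Extn T.E X A, push T.E x η' = η := by
  obtain ⟨N, p, q, hN⟩ := T.exists_realization η
  obtain ⟨K, k, d, e, δ'', -, -, -, hK, -, h2⟩ := T.et4 δ η x y p q h hN
  obtain ⟨r, hr⟩ := exists_lift_of_pull_eq_zero hK (𝟙 X) (by simp [hη])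
  refine ⟨pull T.E r δ'', ?_⟩
  rw [push_pull, h2, ← pull_comp, hr, pull_id]

/-- An endomorphism of a conflation which is the identity at the ends is an isomorphism. -/
lemma isIso_of_ends_eq_id (t : M ⟶ M) (h1 : x ≫ t = x) (h2 : t ≫ y = y) : IsIso t := by
  obtain ⟨g, hg⟩ := exists_desc h (t - 𝟙 M) (by simp [h1])
  -- `t - 1` factors through `y` and is killed by `y`, so it squares to zero; the inverse of `t` is
  -- `2 - t`.
  have sq : t ≫ t - t - t + 𝟙 M = 0 := by
    have : (t - 𝟙 M) ≫ (t - 𝟙 M) = 0 := by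
      conv_lhs => rhs; rw [← hg]
      simp [reassoc_of% h2]
    rw [← this]
    simp only [Preadditive.sub_comp, Preadditive.comp_sub, Category.comp_id, Category.id_comp]
    abel
  refine ⟨𝟙 M + 𝟙 M - t, ?_, ?_⟩ <;>
  · simp only [Preadditive.sub_comp, Preadditive.comp_sub, Preadditive.comp_add,
      Preadditive.add_comp, Category.comp_id, Category.id_comp]
    rw [← sub_eq_zero, ← neg_eq_zero, ← sq]
    abel

end Exactness

/-- Realize the transported extension and compare middle terms in both directions: both composites
fix the ends, so they are isomorphisms by `isIso_of_ends_eq_id`. -/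
lemma Conflation.of_iso {T : Extriangulated.{w} B} {A A' M Z Z' : B} {x : A ⟶ M} {y : M ⟶ Z}
    (h : T.Conflation x y) (a : A ≅ A') (c : Z ≅ Z') :
    T.Conflation (a.inv ≫ x) (y ≫ c.hom) := by
  obtain ⟨δ, hδ⟩ := h
  obtain ⟨N, p, q, hN⟩ := T.exists_realization (push T.E a.hom (pull T.E c.inv δ))
  refine ⟨_, hN.trans ?_⟩
  obtain ⟨b, hb1, hb2⟩ := T.realize_hom δ _ x y p q hδ hN a.hom c.hom
    (by simp [push_pull, ← pull_comp])
  obtain ⟨b', hb1', hb2'⟩ := T.realize_hom _ δ p q x y hN hδ a.inv c.inv (by simp [← push_comp])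
  have i1 : IsIso (b ≫ b') := isIso_of_ends_eq_id hδ _ (by simp [reassoc_of% hb1, hb1'])
    (by simp [← hb2', ← reassoc_of% hb2])
  have i2 : IsIso (b' ≫ b) := isIso_of_ends_eq_id hN _ (by simp [reassoc_of% hb1', hb1])
    (by simp [← hb2, ← reassoc_of% hb2'])
  have e : inv (b' ≫ b) ≫ b' = b' ≫ inv (b ≫ b') := by simp
  have ib : IsIso b := ⟨b' ≫ inv (b ≫ b'), by rw [← Category.assoc, IsIso.hom_inv_id],
    by rw [← e, Category.assoc, IsIso.inv_hom_id]⟩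
  rw [seqClass_eq_iff]
  refine ⟨(asIso b).symm, ?_, ?_⟩
  · simp [hb1]
  · simp [hb2]

/-! ### Composition, pullback and pushout of conflations. -/

section Conflations

variable {T}

lemma Conflation.of_mid_iso {A M M' Z : B} {x : A ⟶ M} {y : M ⟶ Z} (h : T.Conflation x y)
    (b : M ≅ M') : T.Conflation (x ≫ b.hom) (b.inv ≫ y) := by
  obtain ⟨δ, hδ⟩ := h
  exact ⟨δ, hδ.trans (seqClass_eq_iff.2 ⟨b, rfl, by simp⟩)⟩

variable (T) in
lemma conflation_inl_snd (A Z : B) :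
    T.Conflation (biprod.inl : A ⟶ A ⊞ Z) (biprod.snd : A ⊞ Z ⟶ Z) :=
  ⟨0, T.realize_zero A Z⟩

variable (T) in
lemma conflation_inr_fst (A Z : B) :
    T.Conflation (biprod.inr : Z ⟶ A ⊞ Z) (biprod.fst : A ⊞ Z ⟶ A) := by
  have e : biprod.inl ≫ biprod.lift biprod.snd biprod.fst = (biprod.inr : Z ⟶ A ⊞ Z) := by
    ext <;> simp
  simpa [e] using (T.conflation_inl_snd Z A).of_mid_iso (biprod.braiding Z A)

variable (T) in
lemma conflation_zero_id (Z : B) : T.Conflation (0 : (0 : B) ⟶ Z) (𝟙 Z) := by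
  have := (T.conflation_inl_snd (0 : B) Z).of_mid_iso
    ⟨biprod.snd, biprod.inr, by ext; simp, by simp⟩
  simpa using this

lemma Conflation.comp_inflation {A M D N F : B} {f : A ⟶ M} {f' : M ⟶ D} {g : M ⟶ N}
    {g' : N ⟶ F} (hf : T.Conflation f f') (hg : T.Conflation g g') :
    ∃ (K : B) (h' : N ⟶ K) (d : D ⟶ K) (e : K ⟶ F), f' ≫ d = g ≫ h' ∧ h' ≫ e = g' ∧
      T.Conflation (f ≫ g) h' ∧ T.Conflation d e := by
  obtain ⟨δ, hδ⟩ := hf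
  obtain ⟨δ', hδ'⟩ := hg
  obtain ⟨K, h', d, e, δ'', h1, h2, h3, h4, -⟩ := T.et4 δ δ' f f' g g' hδ hδ'
  exact ⟨K, h', d, e, h1, h2, ⟨_, h3⟩, ⟨_, h4⟩⟩

lemma Conflation.comp_deflation {D N M F A : B} {f' : D ⟶ N} {f : N ⟶ M} {g' : F ⟶ M}
    {g : M ⟶ A} (hf : T.Conflation f' f) (hg : T.Conflation g' g) :
    ∃ (K : B) (h' : K ⟶ N) (d : D ⟶ K) (e : K ⟶ F), e ≫ g' = h' ≫ f ∧ d ≫ h' = f' ∧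
      T.Conflation h' (f ≫ g) ∧ T.Conflation d e := by
  obtain ⟨δ, hδ⟩ := hf
  obtain ⟨δ', hδ'⟩ := hg
  obtain ⟨K, h', d, e, δ'', h1, h2, h3, h4, -⟩ := T.et4op δ δ' f' f g' g hδ hδ'
  exact ⟨K, h', d, e, h1, h2, ⟨_, h3⟩, ⟨_, h4⟩⟩

/-- Two conflations with the same right end have a common pullback. -/
lemma Conflation.exists_pullback {A₁ M₁ A₂ M₂ Z : B} {x₁ : A₁ ⟶ M₁} {y₁ : M₁ ⟶ Z} {x₂ : A₂ ⟶ M₂}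
    {y₂ : M₂ ⟶ Z} (h₁ : T.Conflation x₁ y₁) (h₂ : T.Conflation x₂ y₂) :
    ∃ (K : B) (i₁ : A₁ ⟶ K) (p₂ : K ⟶ M₂) (i₂ : A₂ ⟶ K) (p₁ : K ⟶ M₁),
      T.Conflation i₁ p₂ ∧ T.Conflation i₂ p₁ := by
  obtain ⟨δ₁, hδ₁⟩ := h₁
  obtain ⟨δ₂, hδ₂⟩ := h₂
  -- The pullback is the middle term of the extension of `Z` by `A₁ ⊞ A₂` with components `δ₁`,
  -- `δ₂`. Dividing out one summand by (ET4) leaves a realization of the other component.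
  obtain ⟨K, p, q, hK⟩ := T.exists_realization
    (push T.E (biprod.inl : A₁ ⟶ A₁ ⊞ A₂) δ₁ + push T.E biprod.inr δ₂)
  obtain ⟨σ₁, hσ₁⟩ := T.conflation_inl_snd A₁ A₂
  obtain ⟨σ₂, hσ₂⟩ := T.conflation_inr_fst A₁ A₂
  obtain ⟨K₁, k₁, d₁, e₁, η₁, -, -, h1, h2, -⟩ := T.et4 _ _ _ _ _ _ hσ₁ hK
  obtain ⟨K₂, k₂, d₂, e₂, η₂, -, -, h3, h4, -⟩ := T.et4 _ _ _ _ _ _ hσ₂ hK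
  rw [push_add, ← push_comp, ← push_comp] at h2 h4
  simp only [biprod.inl_snd, biprod.inr_snd, biprod.inl_fst, biprod.inr_fst, zero_push, push_id,
    zero_add, add_zero] at h2 h4
  obtain ⟨b₁, -⟩ := seqClass_eq_iff.1 (h2.symm.trans hδ₂)
  obtain ⟨b₂, -⟩ := seqClass_eq_iff.1 (h4.symm.trans hδ₁)
  exact ⟨K, _, _, _, _, Conflation.of_iso ⟨_, h1⟩ (Iso.refl _) b₁,
    Conflation.of_iso ⟨_, h3⟩ (Iso.refl _) b₂⟩

/-- Two conflations with the same left end have a common pushout. -/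
lemma Conflation.exists_pushout {Z₁ M₁ Z₂ M₂ A : B} {x₁ : A ⟶ M₁} {y₁ : M₁ ⟶ Z₁} {x₂ : A ⟶ M₂}
    {y₂ : M₂ ⟶ Z₂} (h₁ : T.Conflation x₁ y₁) (h₂ : T.Conflation x₂ y₂) :
    ∃ (K : B) (i₁ : M₁ ⟶ K) (p₂ : K ⟶ Z₂) (i₂ : M₂ ⟶ K) (p₁ : K ⟶ Z₁),
      T.Conflation i₁ p₂ ∧ T.Conflation i₂ p₁ := by
  obtain ⟨δ₁, hδ₁⟩ := h₁
  obtain ⟨δ₂, hδ₂⟩ := h₂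
  obtain ⟨K, p, q, hK⟩ := T.exists_realization
    (pull T.E (biprod.fst : Z₁ ⊞ Z₂ ⟶ Z₁) δ₁ + pull T.E biprod.snd δ₂)
  obtain ⟨σ₁, hσ₁⟩ := T.conflation_inl_snd Z₁ Z₂
  obtain ⟨σ₂, hσ₂⟩ := T.conflation_inr_fst Z₁ Z₂
  obtain ⟨K₁, k₁, d₁, e₁, η₁, -, -, h1, h2, -⟩ := T.et4op _ _ _ _ _ _ hK hσ₁
  obtain ⟨K₂, k₂, d₂, e₂, η₂, -, -, h3, h4, -⟩ := T.et4op _ _ _ _ _ _ hK hσ₂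
  rw [pull_add, ← pull_comp, ← pull_comp] at h2 h4
  simp only [biprod.inl_snd, biprod.inr_snd, biprod.inl_fst, biprod.inr_fst, zero_pull, pull_id,
    zero_add, add_zero] at h2 h4
  obtain ⟨b₁, -⟩ := seqClass_eq_iff.1 (h2.symm.trans hδ₁)
  obtain ⟨b₂, -⟩ := seqClass_eq_iff.1 (h4.symm.trans hδ₂)
  exact ⟨K, _, _, _, _, Conflation.of_iso ⟨_, h1⟩ b₁ (Iso.refl _),
    Conflation.of_iso ⟨_, h3⟩ b₂ (Iso.refl _)⟩

/-- If `p` is a deflation, then so is `(p, f)`. -/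
lemma Conflation.exists_desc_conflation {A P Y Z : B} {i : A ⟶ P} {p : P ⟶ Z}
    (h : T.Conflation i p) (f : Y ⟶ Z) :
    ∃ (K : B) (k : K ⟶ P ⊞ Y), T.Conflation k (biprod.desc p f) := by
  obtain ⟨δ, hδ⟩ := h
  obtain ⟨ε, hε⟩ := T.conflation_zero_id Y
  have h1 : T.Conflation (biprod.map i (0 : (0 : B) ⟶ Y)) (biprod.map p (𝟙 Y)) :=
    ⟨_, T.realize_dsum δ ε _ _ _ _ hδ hε⟩
  -- A shear of `Z ⊞ Y` turns the first projection into `(𝟙, f)`; preceded by `p ⊕ 𝟙`, this is `(p,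
  -- f)`.
  have h2 := (T.conflation_inr_fst Z Y).of_mid_iso
    ⟨biprod.lift (biprod.fst - biprod.snd ≫ f) biprod.snd,
      biprod.lift (biprod.fst + biprod.snd ≫ f) biprod.snd, by ext <;> simp, by ext <;> simp⟩
  obtain ⟨K, k, -, -, -, -, hk, -⟩ := h1.comp_deflation h2
  refine ⟨K, k, ?_⟩
  have e : biprod.map p (𝟙 Y) ≫ biprod.lift (biprod.fst + biprod.snd ≫ f) biprod.snd ≫
      biprod.fst = biprod.desc p f := by
    ext <;> simp
  rwa [← e]

end Conflations

/-- `𝔼(W, X) = 0`. -/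
def ExtZero (W X : B) : Prop := ∀ δ : Extn T.E W X, δ = 0

/-! ### Vanishing of `𝔼` and dimension shifting. -/

section ExtZero

variable {T}

lemma ExtZero.of_retract_right {W X Y : B} (i : X ⟶ Y) (r : Y ⟶ X) (hir : i ≫ r = 𝟙 X)
    (h : T.ExtZero W Y) : T.ExtZero W X := fun δ => by
  rw [← push_id T.E δ, ← hir, push_comp, h (push T.E i δ), push_zero]

lemma ExtZero.of_isZero_right {W X : B} (hX : IsZero X) : T.ExtZero W X := fun δ => by
  rw [← push_id T.E δ, hX.eq_of_src (𝟙 X) 0, zero_push]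

lemma ExtZero.biprod_right {W X Y : B} (hX : T.ExtZero W X) (hY : T.ExtZero W Y) :
    T.ExtZero W (X ⊞ Y) := fun δ => by
  rw [← push_id T.E δ, ← biprod.total, add_push, push_comp, push_comp, hX (push _ _ δ),
    hY (push _ _ δ)]
  simp

lemma Conflation.extZero_mid {W A M Z : B} {x : A ⟶ M} {y : M ⟶ Z} (h : T.Conflation x y)
    (hA : T.ExtZero W A) (hZ : T.ExtZero W Z) : T.ExtZero W M := fun η => by
  obtain ⟨δ, hδ⟩ := h
  obtain ⟨η', rfl⟩ := exists_push_inflation_eq hδ η (hZ _)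
  rw [hA η', push_zero]

/-- A conflation `A ⟶ M ⟶ Z` with `𝔼(Z, A) = 0` is isomorphic to the split one. -/
lemma Conflation.exists_split {A M Z : B} {x : A ⟶ M} {y : M ⟶ Z} (h : T.Conflation x y)
    (hZA : T.ExtZero Z A) :
    ∃ b : M ≅ A ⊞ Z, x ≫ b.hom = biprod.inl ∧ b.hom ≫ biprod.snd = y := by
  obtain ⟨δ, hδ⟩ := h
  rw [hZA δ] at hδ
  exact seqClass_eq_iff.1 (hδ.symm.trans (T.realize_zero A Z))

lemma Conflation.exists_lift_of_extZero {A M Z X : B} {x : A ⟶ M} {y : M ⟶ Z}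
    (h : T.Conflation x y) (hX : T.ExtZero X A) (f : X ⟶ Z) : ∃ g : X ⟶ M, g ≫ y = f :=
  h.elim fun _ hδ => exists_lift_of_pull_eq_zero hδ f (hX _)

lemma Conflation.exists_extension_of_extZero {A M Z X : B} {x : A ⟶ M} {y : M ⟶ Z}
    (h : T.Conflation x y) (hX : T.ExtZero Z X) (f : A ⟶ X) : ∃ g : M ⟶ X, x ≫ g = f :=
  h.elim fun _ hδ => exists_extension_of_push_eq_zero hδ f (hX _)

/-- If `𝔼(W, M) = 0` and every map `W ⟶ Z` lifts along `y`, then `𝔼(W, A) = 0`. -/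
lemma Conflation.extZero_left {W A M Z : B} {x : A ⟶ M} {y : M ⟶ Z} (h : T.Conflation x y)
    (hM : T.ExtZero W M) (hl : ∀ f : W ⟶ Z, ∃ g : W ⟶ M, g ≫ y = f) : T.ExtZero W A := fun η => by
  obtain ⟨δ, hδ⟩ := h
  obtain ⟨f, rfl⟩ := exists_pull_eq hδ η (hM _)
  obtain ⟨g, rfl⟩ := hl f
  rw [pull_comp, pull_deflation hδ, pull_zero]

/-- If `𝔼(M, X) = 0` and every map `A ⟶ X` extends along `x`, then `𝔼(Z, X) = 0`. -/
lemma Conflation.extZero_right {X A M Z : B} {x : A ⟶ M} {y : M ⟶ Z} (h : T.Conflation x y)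
    (hM : T.ExtZero M X) (hl : ∀ f : A ⟶ X, ∃ g : M ⟶ X, x ≫ g = f) : T.ExtZero Z X := fun η => by
  obtain ⟨δ, hδ⟩ := h
  obtain ⟨f, rfl⟩ := exists_push_eq hδ η (hM _)
  obtain ⟨g, rfl⟩ := hl f
  rw [push_comp, push_inflation hδ, push_zero]

/-- `𝔼(W, C) = 0` follows from `𝔼(W, M) = 0` and `𝔼²(W, A) = 0`, computed by a syzygy of `W`. -/
lemma Conflation.extZero_of_syzygy {A M C K P W : B} {x : A ⟶ M} {y : M ⟶ C}
    {k : K ⟶ P} {p : P ⟶ W} (h : T.Conflation x y) (hW : T.Conflation k p)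
    (hP : T.projectives P) (hM : T.ExtZero W M) (hA : T.ExtZero K A) : T.ExtZero W C := fun η => by
  obtain ⟨ω, hω⟩ := hW
  obtain ⟨f, rfl⟩ := exists_push_eq hω η (hP _ _)
  obtain ⟨g, rfl⟩ := h.exists_lift_of_extZero hA f
  rw [push_comp, hM (push _ _ _), push_zero]

/-- `𝔼²(W, A) = 0` follows from `𝔼(W, C) = 0` and `𝔼²(W, M) = 0`, computed by a syzygy of `W`. -/
lemma Conflation.syzygy_extZero {A M C K P W : B} {x : A ⟶ M} {y : M ⟶ C}
    {k : K ⟶ P} {p : P ⟶ W} (h : T.Conflation x y) (hW : T.Conflation k p)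
    (hP : T.projectives P) (hC : T.ExtZero W C) (hM : T.ExtZero K M) : T.ExtZero K A :=
  h.extZero_left hM fun f => by
    obtain ⟨g, rfl⟩ := hW.exists_extension_of_extZero hC f
    obtain ⟨g', rfl⟩ := h.exists_lift_of_extZero (hP A) g
    exact ⟨k ≫ g', by simp⟩

/-- `𝔼(Z, S) = 0` follows from `𝔼(M, S) = 0` and `𝔼(A, X) = 0`, for a cosyzygy `S` of `X`. -/
lemma Conflation.extZero_cosyzygy {A M Z X I S : B} {x : A ⟶ M} {y : M ⟶ Z} {i : X ⟶ I}
    {q : I ⟶ S} (h : T.Conflation x y) (hS : T.Conflation i q) (hI : T.injectives I)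
    (hM : T.ExtZero M S) (hA : T.ExtZero A X) : T.ExtZero Z S :=
  h.extZero_right hM fun f => by
    obtain ⟨g, rfl⟩ := hS.exists_lift_of_extZero hA f
    obtain ⟨g', rfl⟩ := h.exists_extension_of_extZero (hI Z) g
    exact ⟨g' ≫ q, by simp⟩

/-- Both sides express `𝔼²(W, X) = 0`, once by a cosyzygy of `X` and once by a syzygy of `W`. -/
lemma extZero_cosyzygy_iff {K P W X I S : B} {k : K ⟶ P} {p : P ⟶ W} {i : X ⟶ I} {q : I ⟶ S}
    (hW : T.Conflation k p) (hP : T.projectives P) (hS : T.Conflation i q)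
    (hI : T.injectives I) : T.ExtZero W S ↔ T.ExtZero K X :=
  ⟨fun h => hS.syzygy_extZero hW hP h (hI K), fun h => hS.extZero_of_syzygy hW hP (hI W) h⟩

end ExtZero

variable {T}

lemma exists_cosyzygy_conflation (hI : T.EnoughInjectives) (X : B) :
    ∃ (I : B) (i : X ⟶ I) (q : I ⟶ T.cosyzygy hI X), T.injectives I ∧ T.Conflation i q :=
  ⟨_, _, _, (hI X).choose_spec.choose_spec.1,
    (hI X).choose_spec.choose_spec.2.choose_spec.choose_spec⟩

/-- A chosen syzygy `ΩX`: there is a conflation `ΩX ⟶ P ⟶ X` with `P` projective. -/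
noncomputable def syzygy (hP : T.EnoughProjectives) (X : B) : B :=
  (hP X).choose_spec.choose_spec.2.choose

lemma exists_syzygy_conflation (hP : T.EnoughProjectives) (X : B) :
    ∃ (P : B) (k : syzygy hP X ⟶ P) (p : P ⟶ X), T.projectives P ∧ T.Conflation k p :=
  ⟨_, _, _, (hP X).choose_spec.choose_spec.1,
    (hP X).choose_spec.choose_spec.2.choose_spec.choose_spec⟩

lemma extZero_iterCosyzygy_iff (hP : T.EnoughProjectives) (hI : T.EnoughInjectives) (X : B) :
    ∀ (i : ℕ) (W : B), T.ExtZero W (T.iterCosyzygy hI X i) ↔ T.ExtZero ((syzygy hP)^[i] W) X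
  | 0, W => Iff.rfl
  | i + 1, W => by
    obtain ⟨P, k, p, hP', hk⟩ := exists_syzygy_conflation hP W
    obtain ⟨I, j, q, hI', hj⟩ := exists_cosyzygy_conflation hI (T.iterCosyzygy hI X i)
    rw [Function.iterate_succ_apply, ← extZero_iterCosyzygy_iff hP hI X i]
    exact extZero_cosyzygy_iff hk hP' hj hI'

variable (T) in
/-- `𝒟^{⊥₁}`: objects `X` with `𝔼(𝒟, X) = 0`. -/
def rightPerp (D : ObjectProperty B) : ObjectProperty B := fun X => ∀ Y : B, D Y → T.ExtZero Y X

lemma rightPerp_closed (D : ObjectProperty B) : IsAdditiveSummandClosed (T.rightPerp D) where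
  zero _ hX _ _ := .of_isZero_right hX
  biprod _ _ hX hY W hW := (hX W hW).biprod_right (hY W hW)
  iso _ _ e hX W hW := (hX W hW).of_retract_right e.inv e.hom e.inv_hom_id
  summand _ _ h W hW := (h W hW).of_retract_right biprod.inl biprod.fst biprod.inl_fst

lemma cosyzygies_mono {D D' : ObjectProperty B} (h : D ≤ D') :
    ∀ i, T.cosyzygies D i ≤ T.cosyzygies D' i
  | 0 => h
  | i + 1 => fun _ ⟨X, Y, x, y, hX, hY, hxy⟩ => ⟨X, Y, x, y, cosyzygies_mono h i _ hX, hY, hxy⟩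

/-! ### Cluster tilting subcategories and their layers. -/

section ClusterTilting

variable {hI : T.EnoughInjectives} {n : ℕ} {M : ObjectProperty B}

namespace IsClusterTilting

lemma mem_iff_syzygy (hM : T.IsClusterTilting hI n M) (hP : T.EnoughProjectives) (X : B) :
    M X ↔ ∀ i : ℕ, i + 1 < n → ∀ Y : B, M Y → T.ExtZero ((syzygy hP)^[i] Y) X := by
  simp_rw [hM.mem_iff_right X, ← extZero_iterCosyzygy_iff hP hI]
  rfl

lemma projectives_le (hM : T.IsClusterTilting hI n M) : T.projectives ≤ M := fun P h =>
  (hM.mem_iff_left P).2 fun _ _ _ _ => h _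

lemma injectives_le (hM : T.IsClusterTilting hI n M) (hP : T.EnoughProjectives) :
    T.injectives ≤ M := fun I h =>
  (hM.mem_iff_syzygy hP I).2 fun _ _ _ _ => h _

/-- Every object has a right `M`-approximation that is a deflation. -/
lemma exists_approx (hM : T.IsClusterTilting hI n M) (hP : T.EnoughProjectives)
    (hn : 2 ≤ n) (X : B) :
    ∃ (K L : B) (k : K ⟶ L) (f : L ⟶ X), M L ∧ T.Conflation k f ∧ T.rightPerp M K ∧
      ∀ (Y : B) (g : Y ⟶ X), M Y → ∃ h : Y ⟶ L, h ≫ f = g := by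
  obtain ⟨Y, f, hY, hf⟩ := hM.contravariantlyFinite X
  obtain ⟨P, a, p, hPP, hp⟩ := exists_syzygy_conflation hP X
  -- Adding a projective cover term makes the approximation a deflation and keeps its source in `M`.
  obtain ⟨K, k, hk⟩ := hp.exists_desc_conflation f
  have hL : M (P ⊞ Y) := (hM.mem_iff_syzygy hP _).2 fun i hi W hW =>
    ((hM.mem_iff_syzygy hP _).1 (hM.projectives_le P hPP) i hi W hW).biprod_right
      ((hM.mem_iff_syzygy hP _).1 hY i hi W hW)
  have lift : ∀ (Y' : B) (g : Y' ⟶ X), M Y' → ∃ h : Y' ⟶ P ⊞ Y, h ≫ biprod.desc p f = g :=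
    fun Y' g hY' => by
      obtain ⟨h, rfl⟩ := hf Y' g hY'
      exact ⟨h ≫ biprod.inr, by simp⟩
  exact ⟨K, _, k, _, hL, hk, fun W hW => hk.extZero_left
    ((hM.mem_iff_syzygy hP _).1 hL 0 hn W hW) fun g => lift W g hW, lift⟩

/-- Each cone with middle term in `M` costs one degree of vanishing. Conversely, the kernel of a
right `M`-approximation regains one: degree `i = 0` by the lifting property, the others by shifting.
For `l + 1 ≥ n` the condition is empty. -/
lemma layer_succ_iff (hM : T.IsClusterTilting hI n M) (hP : T.EnoughProjectives) (hn : 2 ≤ n) :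
    ∀ (l : ℕ) (X : B), T.layer M (l + 1) X ↔
      ∀ i : ℕ, i + (l + 1) < n → ∀ Y : B, M Y → T.ExtZero ((syzygy hP)^[i] Y) X
  | 0, X => hM.mem_iff_syzygy hP X
  | l + 1, X => by
    constructor
    · rintro ⟨A, L, x, y, hA, hL, hxy⟩ i hi Y hY
      obtain ⟨P, k, p, hPP, hk⟩ := exists_syzygy_conflation hP ((syzygy hP)^[i] Y)
      refine hxy.extZero_of_syzygy hk hPP ((hM.mem_iff_syzygy hP L).1 hL i (by lia) Y hY) ?_
      rw [← Function.iterate_succ_apply' (syzygy hP)]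
      exact (hM.layer_succ_iff hP hn l A).1 hA (i + 1) (by lia) Y hY
    · intro h
      obtain ⟨K, L, k, f, hL, hk, hK, -⟩ := hM.exists_approx hP hn X
      refine ⟨K, L, k, f, (hM.layer_succ_iff hP hn l K).2 fun i hi Y hY => ?_, hL, hk⟩
      obtain _ | i := i
      · exact hK Y hY
      · obtain ⟨P, j, p, hPP, hj⟩ := exists_syzygy_conflation hP ((syzygy hP)^[i] Y)
        rw [Function.iterate_succ_apply']
        refine hk.syzygy_extZero hj hPP (h i (by lia) Y hY) ?_
        rw [← Function.iterate_succ_apply' (syzygy hP)]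
        exact (hM.mem_iff_syzygy hP L).1 hL (i + 1) (by lia) Y hY

lemma layer_closed (hM : T.IsClusterTilting hI n M) (hP : T.EnoughProjectives) (hn : 2 ≤ n)
    (l : ℕ) : IsAdditiveSummandClosed (T.layer M (l + 1)) := by
  have e := hM.layer_succ_iff hP hn l
  exact
    { zero X hX := (e X).2 fun _ _ _ _ => .of_isZero_right hX
      biprod X Y hX hY := (e _).2 fun i hi W hW =>
        ((e X).1 hX i hi W hW).biprod_right ((e Y).1 hY i hi W hW)
      iso X Y f hX := (e Y).2 fun i hi W hW =>
        ((e X).1 hX i hi W hW).of_retract_right f.inv f.hom f.inv_hom_id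
      summand X Y h := (e X).2 fun i hi W hW =>
        ((e _).1 h i hi W hW).of_retract_right biprod.inl biprod.fst biprod.inl_fst }

lemma layer_mono (hM : T.IsClusterTilting hI n M) (hP : T.EnoughProjectives) (hn : 2 ≤ n)
    {k l : ℕ} (h : k ≤ l) : T.layer M (k + 1) ≤ T.layer M (l + 1) := fun X hX =>
  (hM.layer_succ_iff hP hn l X).2 fun i hi =>
    (hM.layer_succ_iff hP hn k X).1 hX i (by lia)

lemma le_layer (hM : T.IsClusterTilting hI n M) (hP : T.EnoughProjectives) (hn : 2 ≤ n)
    (l : ℕ) : M ≤ T.layer M (l + 1) :=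
  hM.layer_mono hP hn (Nat.zero_le l)

lemma layer_mid (hM : T.IsClusterTilting hI n M) (hP : T.EnoughProjectives) (hn : 2 ≤ n)
    {l : ℕ} {A L Z : B} {x : A ⟶ L} {y : L ⟶ Z} (h : T.Conflation x y)
    (hA : T.layer M (l + 1) A) (hZ : T.layer M (l + 1) Z) : T.layer M (l + 1) L :=
  (hM.layer_succ_iff hP hn l L).2 fun i hi W hW =>
    h.extZero_mid ((hM.layer_succ_iff hP hn l A).1 hA i hi W hW)
      ((hM.layer_succ_iff hP hn l Z).1 hZ i hi W hW)

lemma layer_le_rightPerp (hM : T.IsClusterTilting hI n M) (hP : T.EnoughProjectives) (hn : 2 ≤ n)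
    {l : ℕ} (hl : l + 1 < n) : T.layer M (l + 1) ≤ T.rightPerp M := fun X hX =>
  (hM.layer_succ_iff hP hn l X).1 hX 0 (by lia)

lemma layer_pred_eq (hM : T.IsClusterTilting hI n M) (hP : T.EnoughProjectives) (hn : 2 ≤ n) :
    T.layer M (n - 1) = T.rightPerp M := by
  obtain ⟨m, rfl⟩ := Nat.exists_eq_add_of_le' hn
  refine le_antisymm (hM.layer_le_rightPerp hP hn (l := m) (by lia)) fun X hX =>
    (hM.layer_succ_iff hP hn m X).2 fun i hi => ?_
  obtain rfl : i = 0 := by lia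
  exact hX

/-- The cosyzygy of an object of a layer lies in the next layer. -/
lemma layer_of_cosyzygy (hM : T.IsClusterTilting hI n M) (hP : T.EnoughProjectives)
    {l : ℕ} {X I S : B} {i : X ⟶ I} {q : I ⟶ S} (h : T.Conflation i q) (hII : T.injectives I)
    (hX : T.layer M (l + 1) X) : T.layer M (l + 2) S :=
  ⟨X, I, i, q, hX, hM.injectives_le hP I hII, h⟩

/-! ### Cosyzygies of layers as right orthogonals. -/

lemma cosyzygies_layer_le (hM : T.IsClusterTilting hI n M) (hP : T.EnoughProjectives) (j : ℕ) :
    ∀ l, T.cosyzygies (T.layer M (j + 1)) l ≤ T.layer M (j + l + 1)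
  | 0 => fun _ hX => hX
  | l + 1 => fun _ ⟨_, _, _, _, hX', hII, h⟩ =>
    hM.layer_of_cosyzygy hP h hII (hM.cosyzygies_layer_le hP j l _ hX')

/-- For a cone `L` of `L' ⟶ M₀` and a cosyzygy `X` of `X'`, `𝔼(L, X) = 0` reduces to `𝔼(M₀, X) = 0`,
which holds as `X` lies in a layer below `n`, and to `𝔼(L', X') = 0`, the induction hypothesis. -/
lemma cosyzygies_layer_le_rightPerp (hM : T.IsClusterTilting hI n M) (hP : T.EnoughProjectives)
    (hn : 2 ≤ n) (j : ℕ) : ∀ l, j + l + 1 < n →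
      T.cosyzygies (T.layer M (j + 1)) l ≤ T.rightPerp (T.layer M (l + 1))
  | 0, hl => hM.layer_le_rightPerp hP hn hl
  | l + 1, hl => by
    rintro X ⟨X', I, x, y, hX', hII, h⟩ L ⟨L', M₀, a, b, hL', hM₀, hab⟩
    exact hab.extZero_cosyzygy h hII
      (hM.layer_le_rightPerp hP hn hl X (hM.cosyzygies_layer_le hP j (l + 1) X
        ⟨X', I, x, y, hX', hII, h⟩) M₀ hM₀)
      (hM.cosyzygies_layer_le_rightPerp hP hn j l (by lia) X' hX' L' hL')

/-- An object `X` with `𝔼(M₂, X) = 0` has a right `M`-approximation by an injective object. -/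
lemma exists_injective_approx (hM : T.IsClusterTilting hI n M) (hP : T.EnoughProjectives)
    (hn : 2 ≤ n) {X : B} (hX : T.rightPerp (T.layer M 2) X) :
    ∃ (K I : B) (k : K ⟶ I) (f : I ⟶ X), T.injectives I ∧ T.Conflation k f ∧
      ∀ (Y : B) (g : Y ⟶ X), M Y → ∃ h : Y ⟶ I, h ≫ f = g := by
  obtain ⟨K, M₀, a, f, hM₀, haf, -, lift⟩ := hM.exists_approx hP hn X
  obtain ⟨I, b, c, hII, hbc⟩ := exists_cosyzygy_conflation hI M₀
  obtain ⟨Z, h', d, e, hd, -, hZ, hde⟩ := haf.comp_inflation hbc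
  -- The pushout `X ⟶ Z ⟶ ΣM₀` splits because `ΣM₀` lies in `M₂`; hence the approximation `f`
  -- factors through `I`, by the deflation `I ⟶ Z ≅ X ⊞ ΣM₀ ⟶ X`.
  obtain ⟨β, hβ, -⟩ := hde.exists_split (hX _ (hM.layer_of_cosyzygy hP (l := 0) hbc hII hM₀))
  obtain ⟨K', k, -, -, -, -, hk, -⟩ :=
    hZ.comp_deflation ((T.conflation_inr_fst _ _).of_mid_iso β.symm)
  refine ⟨K', I, k, _, hII, hk, fun Y g hY => ?_⟩
  obtain ⟨t, rfl⟩ := lift Y g hY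
  exact ⟨t ≫ b, by simp [← reassoc_of% hd, reassoc_of% hβ]⟩

/-- An injective `M`-approximation exhibits `X` as a cosyzygy of its kernel `K`, and both hypotheses
pass to `K` with `l` lowered by one. -/
lemma rightPerp_inf_layer_le_cosyzygies (hM : T.IsClusterTilting hI n M)
    (hP : T.EnoughProjectives) (hn : 2 ≤ n) (j : ℕ) : ∀ (l : ℕ) (X : B),
      T.rightPerp (T.layer M (l + 1)) X → T.layer M (j + l + 1) X →
        T.cosyzygies (T.layer M (j + 1)) l X
  | 0, _, _, hX' => hX'
  | l + 1, X, hX, hX' => by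
    obtain ⟨K, I, k, f, hII, hk, lift⟩ := hM.exists_injective_approx hP hn
      (X := X) fun W hW => hX W (hM.layer_mono hP hn (k := 1) (by lia) W hW)
    refine ⟨K, I, k, f, hM.rightPerp_inf_layer_le_cosyzygies hP hn j l K ?_ ?_, hII, hk⟩
    · refine fun W hW => hk.extZero_left (hII W) fun g => ?_
      -- A map `W ⟶ X` extends to an injective `J` since `ΣW` is in the next layer; as `J` lies in
      -- `M`, the extension lifts to `I`.
      obtain ⟨J, b, c, hJ, hbc⟩ := exists_cosyzygy_conflation hI W
      obtain ⟨g', rfl⟩ := hbc.exists_extension_of_extZero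
        (hX _ (hM.layer_of_cosyzygy hP hbc hJ hW)) g
      obtain ⟨h, rfl⟩ := lift J g' (hM.injectives_le hP J hJ)
      exact ⟨b ≫ h, by simp⟩
    · refine (hM.layer_succ_iff hP hn _ K).2 fun i hi Y hY => ?_
      obtain _ | i := i
      · exact hk.extZero_left (hII Y) fun g => lift Y g hY
      · obtain ⟨P, a, p, hPP, ha⟩ := exists_syzygy_conflation hP ((syzygy hP)^[i] Y)
        rw [Function.iterate_succ_apply']
        exact hk.syzygy_extZero ha hPP
          ((hM.layer_succ_iff hP hn _ X).1 hX' i (by lia) Y hY) (hII _)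

/-- With `n = j + l + 2`, the layer condition in the hard inclusion is automatic: `M_{l+1}^{⊥₁}`
lies in `M^{⊥₁} = M_{j+l+1}`. -/
lemma colayer_eq (hM : T.IsClusterTilting hI n M) (hP : T.EnoughProjectives) (hn : 2 ≤ n)
    {l : ℕ} (hl : l + 1 < n) : T.colayer n M (l + 1) = T.rightPerp (T.layer M (l + 1)) := by
  obtain ⟨j, rfl⟩ : ∃ j, n = j + l + 2 := ⟨n - (l + 2), by lia⟩
  have e : T.colayer (j + l + 2) M (l + 1) = T.cosyzygies (T.layer M (j + 1)) l := by
    simp only [colayer, Nat.add_sub_cancel]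
    congr 2
    lia
  rw [e]
  refine le_antisymm (hM.cosyzygies_layer_le_rightPerp hP hn j l (by lia)) fun X hX =>
    hM.rightPerp_inf_layer_le_cosyzygies hP hn j l X hX ?_
  have h := hM.layer_pred_eq hP hn
  simp only [Nat.add_one_sub_one] at h
  rw [h]
  exact fun W hW => hX W (hM.le_layer hP hn l W hW)

lemma core_eq (hM : T.IsClusterTilting hI n M) (hP : T.EnoughProjectives) (hn : 2 ≤ n)
    {l : ℕ} (hl : l + 1 < n) :
    core (T.layer M (l + 1)) (T.rightPerp (T.layer M (l + 1))) = T.cosyzygies M l := by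
  refine le_antisymm (fun X hX => ?_) fun X hX => ⟨?_, ?_⟩
  · exact hM.rightPerp_inf_layer_le_cosyzygies hP hn 0 l X hX.2 (by simpa using hX.1)
  · simpa using hM.cosyzygies_layer_le hP 0 l X hX
  · exact hM.cosyzygies_layer_le_rightPerp hP hn 0 l (by lia) X hX

/-! ### Cotorsion pairs, kernels and cohearts. -/

lemma exists_rightPerp_coresolution (hM : T.IsClusterTilting hI n M) (hP : T.EnoughProjectives)
    (hn : 2 ≤ n) : ∀ l, l + 1 < n → ∀ Z : B, ∃ (K L : B) (x : Z ⟶ K) (y : K ⟶ L),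
      T.rightPerp (T.layer M (l + 1)) K ∧ T.layer M (l + 1) L ∧ T.Conflation x y
  | 0, _, Z => by
    obtain ⟨I, i, q, hII, hiq⟩ := exists_cosyzygy_conflation hI Z
    obtain ⟨V, U, k, f, hU, hk, hV, -⟩ := hM.exists_approx hP hn (T.cosyzygy hI Z)
    -- The middle term `N` is an extension of the injective `I` by `V`, hence in `M^{⊥₁}`.
    obtain ⟨N, i₁, p₂, i₂, p₁, h₁, h₂⟩ := hiq.exists_pullback hk
    exact ⟨N, U, i₁, p₂, fun W hW => h₂.extZero_mid (hV W hW) (hII W), hU, h₁⟩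
  | l + 1, hl, Z => by
    -- First embed `Z` in `X ∈ M^{⊥₁}`. Coresolving `ΩX` by induction and pushing out gives `V₁ ⟶ U
    -- ⟶ X` with `U` in `M_{l+1}`.
    obtain ⟨X, M₀, z, m, hX, hM₀, hzm⟩ := hM.exists_rightPerp_coresolution hP hn 0 hn Z
    obtain ⟨PX, a, p, hPX, hap⟩ := exists_syzygy_conflation hP X
    obtain ⟨V₁, U₁, v₁, u₁, hV₁, hU₁, h₁⟩ :=
      hM.exists_rightPerp_coresolution hP hn l (by lia) (syzygy hP X)
    obtain ⟨U, i₁, p₂, i₂, p₁, h₂, h₃⟩ := hap.exists_pushout h₁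
    have hU : T.layer M (l + 1) U :=
      hM.layer_mid hP hn h₂ (hM.le_layer hP hn l _ (hM.projectives_le _ hPX)) hU₁
    obtain ⟨I, i, q, hII, hiq⟩ := exists_cosyzygy_conflation hI U
    -- `D` is a cosyzygy of `V₁` containing `X` with quotient `ΣU`; so `Z ⟶ D` has as cokernel an
    -- extension of `ΣU` by `M₀`, which lies in `M_{l+2}`.
    obtain ⟨D, h', d, e, -, -, hD, hde⟩ := h₃.comp_inflation hiq
    have hDM : T.rightPerp M D := fun W hW => by
      obtain ⟨P, b, c, hPP, hbc⟩ := exists_syzygy_conflation hP W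
      exact hD.extZero_of_syzygy hbc hPP (hII W) (h₃.syzygy_extZero hbc hPP (hX W hW)
        ((hM.layer_succ_iff hP hn l U).1 hU 1 (by lia) W hW))
    obtain ⟨N, h'', d', e', -, -, hN, hde'⟩ := hzm.comp_inflation hde
    refine ⟨D, N, _, _, ?_, hM.layer_mid hP hn hde' (hM.le_layer hP hn _ _ hM₀)
      (hM.layer_of_cosyzygy hP hiq hII hU), hN⟩
    rintro L ⟨L', M₁, s, t, hL', hM₁, hst⟩
    exact hst.extZero_cosyzygy hD hII (hDM M₁ hM₁) (hV₁ L' hL')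

/-- Coresolve `ΩZ` and push out along `ΩZ ⟶ P`. -/
lemma exists_layer_resolution (hM : T.IsClusterTilting hI n M) (hP : T.EnoughProjectives)
    (hn : 2 ≤ n) {l : ℕ} (hl : l + 1 < n) (Z : B) : ∃ (K L : B) (x : K ⟶ L) (y : L ⟶ Z),
      T.rightPerp (T.layer M (l + 1)) K ∧ T.layer M (l + 1) L ∧ T.Conflation x y := by
  obtain ⟨P, a, p, hPP, hap⟩ := exists_syzygy_conflation hP Z
  obtain ⟨V, U, v, w, hV, hU, hvw⟩ :=
    hM.exists_rightPerp_coresolution hP hn l hl (syzygy hP Z)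
  obtain ⟨N, i₁, p₂, i₂, p₁, h₁, h₂⟩ := hap.exists_pushout hvw
  exact ⟨V, N, i₂, p₁, hV,
    hM.layer_mid hP hn h₁ (hM.le_layer hP hn l P (hM.projectives_le P hPP)) hU, h₂⟩

lemma isCotorsionPair (hM : T.IsClusterTilting hI n M) (hP : T.EnoughProjectives)
    (hn : 2 ≤ n) {l : ℕ} (hl : l + 1 < n) :
    T.IsCotorsionPair (T.layer M (l + 1)) (T.rightPerp (T.layer M (l + 1))) where
  left_closed := hM.layer_closed hP hn l
  right_closed := rightPerp_closed _
  ext_zero _ _ hX hY := hY _ hX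
  left_approx := hM.exists_layer_resolution hP hn hl
  right_approx := hM.exists_rightPerp_coresolution hP hn l hl

lemma kernel_eq (hM : T.IsClusterTilting hI n M) (hP : T.EnoughProjectives) (hn : 2 ≤ n)
    {l : ℕ} (hl : l + 1 < n) :
    T.kernel (T.layer M (l + 1)) (T.rightPerp (T.layer M (l + 1))) = T.rightPerp M := by
  refine le_antisymm ?_ fun X hX => ?_
  · rintro X ⟨X', Y, ⟨U, V, x, y, hU, hV, hxy⟩, ⟨e⟩⟩ W hW
    have hY : T.ExtZero W Y := hxy.extZero_mid (hM.layer_le_rightPerp hP hn hl U hU W hW)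
      (hV W (hM.le_layer hP hn l W hW))
    exact hY.of_retract_right (biprod.inl ≫ e.hom) (e.inv ≫ biprod.fst) (by simp)
  · obtain _ | l := l
    · exact ⟨0, X, ⟨0, X, 0, 𝟙 X, (hM.layer_closed hP hn 0).zero _ (isZero_zero B), hX,
        T.conflation_zero_id X⟩, ⟨biprod.fst, biprod.inl, by ext; simp, by simp⟩⟩
    · obtain ⟨V, U, x, y, hV, ⟨L, M₀, a, b, hL, hM₀, hab⟩, hxy⟩ :=
        hM.exists_rightPerp_coresolution hP hn (l + 1) hl X
      -- The pullback `N` is an extension of `V` by `L`, and also of `M₀` by `X`; the latter splits,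
      -- making `X` a summand of `N`.
      obtain ⟨N, i₁, p₂, i₂, p₁, h₁, h₂⟩ := hxy.exists_pullback hab
      obtain ⟨β, -⟩ := h₁.exists_split (hX M₀ hM₀)
      exact ⟨M₀, N, ⟨L, V, i₂, p₁, hM.layer_mono hP hn (Nat.le_succ l) L hL, hV, h₂⟩, ⟨β.symm⟩⟩

/-- If `K ⟶ L ⟶ X` is a conflation with `L` in `M` and `𝔼(X, K) = 0`, then `X` lies in `M`. -/
lemma mem_of_extZero (hM : T.IsClusterTilting hI n M) (hP : T.EnoughProjectives)
    {X K L : B} {k : K ⟶ L} {f : L ⟶ X} (h : T.Conflation k f) (hL : M L)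
    (hX : T.ExtZero X K) : M X := by
  obtain ⟨s, hs⟩ := h.exists_lift_of_extZero hX (𝟙 X)
  exact (hM.mem_iff_syzygy hP X).2 fun i hi Y hY =>
    ((hM.mem_iff_syzygy hP L).1 hL i hi Y hY).of_retract_right s f hs

lemma leftPerp_rightPerp_eq (hM : T.IsClusterTilting hI n M) (hP : T.EnoughProjectives)
    (hn : 2 ≤ n) : T.leftPerp (T.rightPerp M) = M := by
  refine le_antisymm (fun X hX => ?_) fun X hX A hA => hA X hX
  obtain ⟨K, L, k, f, hL, hk, hK, -⟩ := hM.exists_approx hP hn X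
  exact hM.mem_of_extZero hP hk hL (hX K hK)

/-- The conflation defining the layer has its kernel in a smaller layer, so it splits for `X` left
orthogonal to the layer. -/
lemma layer_inf_leftPerp_eq (hM : T.IsClusterTilting hI n M) (hP : T.EnoughProjectives)
    (hn : 2 ≤ n) {l : ℕ} (hl : l + 1 < n) :
    (fun X => T.layer M (l + 1) X ∧ T.leftPerp (T.layer M (l + 1)) X) = M := by
  funext X
  refine propext ⟨fun ⟨hX, hX'⟩ => ?_, fun hX => ⟨hM.le_layer hP hn l X hX,
    fun A hA => hM.layer_le_rightPerp hP hn hl A hA X hX⟩⟩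
  obtain _ | l := l
  · exact hX
  · obtain ⟨K, L, k, f, hK, hL, hk⟩ := hX
    exact hM.mem_of_extZero hP hk hL (hX' K (hM.layer_mono hP hn (Nat.le_succ l) K hK))

end IsClusterTilting
end ClusterTilting

end Extriangulated
end ExtriCat

theorem mainTheorem7 {B : Type u} [Category.{v} B] [Preadditive B] [HasZeroObject B]
    [HasBinaryBiproducts B] (T : ExtriCat.Extriangulated.{w} B)
    (_hP : T.EnoughProjectives) (hI : T.EnoughInjectives)
    (n : ℕ) (_hn : 2 ≤ n) (M : ObjectProperty B) (_hM : T.IsClusterTilting hI n M) :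
    (∀ ℓ : ℕ, 1 ≤ ℓ → ℓ ≤ n - 1 →
      T.IsCotorsionPair (T.layer M ℓ) (T.colayer n M ℓ) ∧
      ExtriCat.Extriangulated.core (T.layer M ℓ) (T.colayer n M ℓ) = T.cosyzygies M (ℓ - 1) ∧
      T.coheart (T.layer M ℓ) (T.colayer n M ℓ) = M ∧
      (fun X => T.layer M ℓ X ∧ T.leftPerp (T.layer M ℓ) X) = M ∧
      T.kernel (T.layer M ℓ) (T.colayer n M ℓ) = T.layer M (n - 1)) ∧
    (∀ k ℓ : ℕ, 1 ≤ k → k ≤ ℓ → ℓ ≤ n - 1 →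
      T.layer M k ≤ T.layer M ℓ ∧ T.colayer n M ℓ ≤ T.colayer n M k) := by
  refine ⟨fun ℓ h1 h2 => ?_, fun k ℓ h1 h2 h3 => ?_⟩
  · obtain ⟨l, rfl⟩ := Nat.exists_eq_add_of_le' h1
    have hl : l + 1 < n := by lia
    rw [_hM.colayer_eq _hP _hn hl, _hM.layer_pred_eq _hP _hn]
    refine ⟨_hM.isCotorsionPair _hP _hn hl, _hM.core_eq _hP _hn hl, ?_,
      _hM.layer_inf_leftPerp_eq _hP _hn hl, _hM.kernel_eq _hP _hn hl⟩
    rw [ExtriCat.Extriangulated.coheart, _hM.kernel_eq _hP _hn hl,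
      _hM.leftPerp_rightPerp_eq _hP _hn]
  · obtain ⟨m, rfl⟩ := Nat.exists_eq_add_of_le' h1
    obtain ⟨l, rfl⟩ := Nat.exists_eq_add_of_le' (h1.trans h2)
    have hml := _hM.layer_mono _hP _hn (Nat.le_of_succ_le_succ h2)
    rw [_hM.colayer_eq _hP _hn (l := l) (by lia), _hM.colayer_eq _hP _hn (l := m) (by lia)]
    exact ⟨hml, fun X hX W hW => hX W (hml W hW)⟩
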